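/- Theorem 5.4. Let $R$ be an associative ring with unit (not necessarily commutative). An $R$-algebra is a ring $S$ with a ring homomorphism $R\to S$ (whose image need not be central). A functor of (left) $\mathcal R$-modules is a covariant functor $\mathbb M$ from $R$-algebras to abelian groups together with a left $S$-module structure on $\mathbb M(S)$ for every $R$-algebra $S$ such that $\mathbb M(f)(s\cdot m)=f(s)\cdot\mathbb M(f)(m)$ for every morphism of $R$-algebras $f\colon S\to T$; its morphisms are the natural transformations with $S$-linear components. Functors of right $\mathcal R$-modules are defined in the same way. Let $\mathcal R(S):=S$, and for an $R$-algebra $S$ let $\mathbb M_{|S}$ be the restriction of $\mathbb M$ to $S$-algebras and let $\mathcal S:=\mathcal R_{|S}$. For a functor $\mathbb M$ of left (resp. right) $\mathcal R$-modules let $\mathbb M^*:=\mathbb Hom_{\mathcal R}(\mathbb M,\mathcal R)$, that is, $$\mathbb M^*(S):=\operatorname{Hom}_{\mathcal S}(\mathbb M_{|S},\mathcal S)$$ for every $R$-algebra $S$, with transition maps given by restriction; this is a functor of right (resp. left) $\mathcal R$-modules via $(\varphi\cdot s)(m)=\varphi(m)s$ (resp. $(s\cdot\varphi)(m)=s\varphi(m)$).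 Let $M$ be a left $R$-module and let $\mathcal M$ be the functor of $\mathcal R$-modules $\mathcal M(S):=S\otimes_R M$. Then the natural morphism of functors of $\mathcal R$-modules $$\mathcal M\longrightarrow \mathcal M^{**},$$ which sends $m\in\mathcal M(S)$ to the morphism $(\mathcal M^*)_{|S}\to\mathcal S$ given on an $S$-algebra $T$ by $\varphi\mapsto\varphi_T(m_T)$ (where $\varphi\in\mathcal M^*(T)$, and $m_T\in\mathcal M(T)$ is the image of $m$), is an isomorphism. -/

import Mathlib

open CategoryTheory MulOpposite
open scoped TensorProduct

universe u w w'

/-- The category `R-Alg` of (not necessarily commutative) `R`-algebras, for an associative unital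
ring `R`: an `R`-algebra is a ring `S` together with a ring homomorphism `R → S` (whose image need
not be central), and the morphisms are the ring homomorphisms under `R`. -/
abbrev RAlg (R : Type u) [Ring R] : Type (u + 1) := Under (RingCat.of R)

/-- The structure homomorphism `R → S` of an `R`-algebra. -/
def RAlg.str {R : Type u} [Ring R] (S : RAlg R) : R →+* S.right := S.hom.hom

/-- The ring homomorphism underlying a morphism of `R`-algebras. -/
abbrev RAlg.hom {R : Type u} [Ring R] {S T : RAlg R} (f : S ⟶ T) : S.right →+* T.right :=
  f.right.hom

theorem RAlg.hom_str {R : Type u} [Ring R] {S T : RAlg R} (f : S ⟶ T) (r : R) :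
    RAlg.hom f (S.str r) = T.str r :=
  congrArg (fun k : (RingCat.of R) ⟶ T.right => k.hom r) (Under.w f)

/-- A functor of (left) `𝓡`-modules: a covariant functor from `R`-algebras to abelian groups, with
an `S`-module structure on the value at each `S`, the action `𝓡 × 𝕄 → 𝕄` being natural. Naturality
of the action together with additivity says exactly that the transition map along `f : S ⟶ T` is
semilinear with respect to `f`. -/
structure LeftModFunctor (R : Type u) [Ring R] where
  obj : RAlg R → Type w
  [addCommGroup : ∀ S, AddCommGroup (obj S)]
  [module : ∀ S : RAlg R, Module S.right (obj S)]
  map : ∀ {S T : RAlg R} (f : S ⟶ T), obj S →ₛₗ[RAlg.hom f] obj T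
  map_id : ∀ (S : RAlg R) (x : obj S), map (𝟙 S) x = x
  map_comp : ∀ {S T U : RAlg R} (f : S ⟶ T) (g : T ⟶ U) (x : obj S),
    map (f ≫ g) x = map g (map f x)

/-- A functor of right `𝓡`-modules. A right `S`-module is a module over `Sᵐᵒᵖ`. -/
structure RightModFunctor (R : Type u) [Ring R] where
  obj : RAlg R → Type w
  [addCommGroup : ∀ S, AddCommGroup (obj S)]
  [module : ∀ S : RAlg R, Module (S.right)ᵐᵒᵖ (obj S)]
  map : ∀ {S T : RAlg R} (f : S ⟶ T), obj S →ₛₗ[RingHom.op (RAlg.hom f)] obj T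
  map_id : ∀ (S : RAlg R) (x : obj S), map (𝟙 S) x = x
  map_comp : ∀ {S T U : RAlg R} (f : S ⟶ T) (g : T ⟶ U) (x : obj S),
    map (f ≫ g) x = map g (map f x)

attribute [instance] LeftModFunctor.addCommGroup LeftModFunctor.module
attribute [instance] RightModFunctor.addCommGroup RightModFunctor.module

namespace LeftModFunctor

variable {R : Type u} [Ring R]

/-- The functor `𝓡` itself, `𝓡(S) = S`, as a functor of left `𝓡`-modules. -/
abbrev self (R : Type u) [Ring R] : LeftModFunctor.{u, u} R where
  obj S := S.right
  map f := { toFun := RAlg.hom f, map_add' := map_add _, map_smul' := map_mul _ }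
  map_id _ _ := rfl
  map_comp _ _ _ := rfl

/-- A morphism of functors of `𝓡`-modules: a natural transformation with `S`-linear components. -/
structure Hom (F : LeftModFunctor.{u, w} R) (G : LeftModFunctor.{u, w'} R) where
  app : ∀ S : RAlg R, F.obj S →ₗ[S.right] G.obj S
  naturality : ∀ {S T : RAlg R} (f : S ⟶ T) (x : F.obj S),
    app T (F.map f x) = G.map f (app S x)

/-- A morphism of functors of `𝓡`-modules is an isomorphism if it has a two-sided inverse which is
again a morphism of functors of `𝓡`-modules. -/
def Hom.IsIso {F : LeftModFunctor.{u, w} R} {G : LeftModFunctor.{u, w'} R} (φ : Hom F G) : Prop :=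
  ∃ ψ : Hom G F, (∀ S x, ψ.app S (φ.app S x) = x) ∧ (∀ S y, φ.app S (ψ.app S y) = y)

/-- The group `ℍom(F, G)(S) = Hom_𝓢(F|_S, G|_S)` of morphisms of functors of `𝓢`-modules between
the restrictions of `F` and `G` to the category of `S`-algebras. An `S`-algebra is the same thing
as an `R`-algebra `T` with a morphism `h : S ⟶ T` of `R`-algebras, and a morphism of `S`-algebras
from `(T, h)` to `(T', h')` is a `g : T ⟶ T'` with `h ≫ g = h'`; so an element is a family of
`T`-linear maps `F(T) → G(T)`, one for each `(T, h)`, natural in `(T, h)`. -/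
def homOver (F : LeftModFunctor.{u, w} R) (G : LeftModFunctor.{u, w'} R) (S : RAlg R) :
    AddSubgroup (∀ (T : RAlg R) (_ : S ⟶ T), F.obj T →ₗ[T.right] G.obj T) where
  carrier := {φ | ∀ (T T' : RAlg R) (h : S ⟶ T) (g : T ⟶ T') (x : F.obj T),
    φ T' (h ≫ g) (F.map g x) = G.map g (φ T h x)}
  zero_mem' := by intro T T' h g x; simp
  add_mem' := by intro φ ψ hφ hψ T T' h g x; simp [hφ T T' h g x, hψ T T' h g x]
  neg_mem' := by intro φ hφ T T' h g x; simp [hφ T T' h g x]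

/-- The right `S`-module structure on `Hom_𝓢(F|_S, 𝓢)`: `(φ · s)_T(x) = φ_T(x) · h(s)`
for an `S`-algebra `h : S ⟶ T`. -/
instance dualModule (F : LeftModFunctor.{u, w} R) (S : RAlg R) :
    Module (S.right)ᵐᵒᵖ (homOver F (self R) S) where
  smul := fun s φ => ⟨fun T h =>
      { toFun := fun x => ((φ.1 T h x : T.right) * RAlg.hom h (unop s) : T.right)
        map_add' := fun x y => by
          rw [map_add]; exact add_mul (R := T.right) _ _ _
        map_smul' := fun t x => by
          rw [map_smul]; exact mul_assoc (G := T.right) _ _ _ },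
    fun T T' h g x => by
      change (φ.1 T' (h ≫ g) (F.map g x) : T'.right) * RAlg.hom g (RAlg.hom h (unop s)) =
        RAlg.hom g ((φ.1 T h x : T.right) * RAlg.hom h (unop s))
      rw [map_mul, φ.2 T T' h g x]; rfl⟩
  one_smul := fun φ => Subtype.ext <| funext fun T => funext fun h => LinearMap.ext fun x => by
    change (φ.1 T h x : T.right) * RAlg.hom h 1 = φ.1 T h x
    rw [map_one]; exact mul_one (M := T.right) _
  mul_smul := fun s t φ => Subtype.ext <| funext fun T => funext fun h =>
    LinearMap.ext fun x => by
    change (φ.1 T h x : T.right) * RAlg.hom h (unop t * unop s) =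
      (φ.1 T h x : T.right) * RAlg.hom h (unop t) * RAlg.hom h (unop s)
    rw [map_mul, mul_assoc]
  smul_zero := fun s => Subtype.ext <| funext fun T => funext fun h => LinearMap.ext fun x =>
    zero_mul (M₀ := T.right) _
  smul_add := fun s φ ψ => Subtype.ext <| funext fun T => funext fun h =>
    LinearMap.ext fun x => add_mul (R := T.right) _ _ _
  add_smul := fun s t φ => Subtype.ext <| funext fun T => funext fun h =>
    LinearMap.ext fun x => by
    change (φ.1 T h x : T.right) * RAlg.hom h (unop s + unop t) =
      (φ.1 T h x : T.right) * RAlg.hom h (unop s) + (φ.1 T h x : T.right) * RAlg.hom h (unop t)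
    rw [map_add, mul_add]
  zero_smul := fun φ => Subtype.ext <| funext fun T => funext fun h => LinearMap.ext fun x => by
    change (φ.1 T h x : T.right) * RAlg.hom h 0 = 0
    rw [map_zero, mul_zero]

/-- The dual functor of right `𝓡`-modules `F^* = ℍom(F, 𝓡)`; the transition map along `f : S ⟶ S'`
restricts a morphism of functors on `S`-algebras to the `S'`-algebras. -/
abbrev dual (F : LeftModFunctor.{u, w} R) : RightModFunctor.{u, max (u + 1) w} R where
  obj S := homOver F (self R) S
  map {S S'} f :=
    { toFun := fun φ => ⟨fun T h => φ.1 T (f ≫ h), fun T T' h g x => by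
        change φ.1 T' (f ≫ h ≫ g) (F.map g x) = RAlg.hom g (φ.1 T (f ≫ h) x)
        rw [← Category.assoc]; exact φ.2 T T' (f ≫ h) g x⟩
      map_add' := fun _ _ => rfl
      map_smul' := fun _ _ => rfl }
  map_id S φ := Subtype.ext <| funext fun T => funext fun h => by
    change φ.1 T (𝟙 S ≫ h) = φ.1 T h
    rw [Category.id_comp]
  map_comp f g φ := Subtype.ext <| funext fun T => funext fun h => by
    change φ.1 T ((f ≫ g) ≫ h) = φ.1 T (f ≫ g ≫ h)
    rw [Category.assoc]

end LeftModFunctor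

namespace RightModFunctor

variable {R : Type u} [Ring R]

/-- The functor `𝓡` itself, `𝓡(S) = S`, as a functor of right `𝓡`-modules. -/
abbrev self (R : Type u) [Ring R] : RightModFunctor.{u, u} R where
  obj S := S.right
  map f :=
    { toFun := RAlg.hom f
      map_add' := map_add _
      map_smul' := fun s x => map_mul (RAlg.hom f) x (unop s) }
  map_id _ _ := rfl
  map_comp _ _ _ := rfl

/-- The group `ℍom(F, G)(S) = Hom_𝓢(F|_S, G|_S)` for functors of right `𝓡`-modules. -/
def homOver (F : RightModFunctor.{u, w} R) (G : RightModFunctor.{u, w'} R) (S : RAlg R) :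
    AddSubgroup (∀ (T : RAlg R) (_ : S ⟶ T), F.obj T →ₗ[(T.right)ᵐᵒᵖ] G.obj T) where
  carrier := {φ | ∀ (T T' : RAlg R) (h : S ⟶ T) (g : T ⟶ T') (x : F.obj T),
    φ T' (h ≫ g) (F.map g x) = G.map g (φ T h x)}
  zero_mem' := by intro T T' h g x; simp
  add_mem' := by intro φ ψ hφ hψ T T' h g x; simp [hφ T T' h g x, hψ T T' h g x]
  neg_mem' := by intro φ hφ T T' h g x; simp [hφ T T' h g x]

/-- The left `S`-module structure on `Hom_𝓢(F|_S, 𝓢)`: `(s · φ)_T(x) = h(s) · φ_T(x)`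
for an `S`-algebra `h : S ⟶ T`. -/
instance dualModule (F : RightModFunctor.{u, w} R) (S : RAlg R) :
    Module S.right (homOver F (self R) S) where
  smul := fun s φ => ⟨fun T h =>
      { toFun := fun x => (RAlg.hom h s * (φ.1 T h x : T.right) : T.right)
        map_add' := fun x y => by
          rw [map_add]; exact mul_add (R := T.right) _ _ _
        map_smul' := fun t x => by
          rw [map_smul]; exact (mul_assoc (G := T.right) _ _ _).symm },
    fun T T' h g x => by
      change RAlg.hom g (RAlg.hom h s) * (φ.1 T' (h ≫ g) (F.map g x) : T'.right) =
        RAlg.hom g (RAlg.hom h s * (φ.1 T h x : T.right))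
      rw [map_mul, φ.2 T T' h g x]; rfl⟩
  one_smul := fun φ => Subtype.ext <| funext fun T => funext fun h => LinearMap.ext fun x => by
    change RAlg.hom h 1 * (φ.1 T h x : T.right) = φ.1 T h x
    rw [map_one]; exact one_mul (M := T.right) _
  mul_smul := fun s t φ => Subtype.ext <| funext fun T => funext fun h =>
    LinearMap.ext fun x => by
    change RAlg.hom h (s * t) * (φ.1 T h x : T.right) =
      RAlg.hom h s * (RAlg.hom h t * (φ.1 T h x : T.right))
    rw [map_mul, mul_assoc]
  smul_zero := fun s => Subtype.ext <| funext fun T => funext fun h => LinearMap.ext fun x =>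
    mul_zero (M₀ := T.right) _
  smul_add := fun s φ ψ => Subtype.ext <| funext fun T => funext fun h =>
    LinearMap.ext fun x => mul_add (R := T.right) _ _ _
  add_smul := fun s t φ => Subtype.ext <| funext fun T => funext fun h =>
    LinearMap.ext fun x => by
    change RAlg.hom h (s + t) * (φ.1 T h x : T.right) =
      RAlg.hom h s * (φ.1 T h x : T.right) + RAlg.hom h t * (φ.1 T h x : T.right)
    rw [map_add, add_mul]
  zero_smul := fun φ => Subtype.ext <| funext fun T => funext fun h => LinearMap.ext fun x => by
    change RAlg.hom h 0 * (φ.1 T h x : T.right) = 0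
    rw [map_zero, zero_mul]

/-- The dual functor of left `𝓡`-modules `F^* = ℍom(F, 𝓡)` of a functor of right `𝓡`-modules. -/
abbrev dual (F : RightModFunctor.{u, w} R) : LeftModFunctor.{u, max (u + 1) w} R where
  obj S := homOver F (self R) S
  map {S S'} f :=
    { toFun := fun φ => ⟨fun T h => φ.1 T (f ≫ h), fun T T' h g x => by
        change φ.1 T' (f ≫ h ≫ g) (F.map g x) = RAlg.hom g (φ.1 T (f ≫ h) x)
        rw [← Category.assoc]; exact φ.2 T T' (f ≫ h) g x⟩
      map_add' := fun _ _ => rfl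
      map_smul' := fun _ _ => rfl }
  map_id S φ := Subtype.ext <| funext fun T => funext fun h => by
    change φ.1 T (𝟙 S ≫ h) = φ.1 T h
    rw [Category.id_comp]
  map_comp f g φ := Subtype.ext <| funext fun T => funext fun h => by
    change φ.1 T ((f ≫ g) ≫ h) = φ.1 T (f ≫ g ≫ h)
    rw [Category.assoc]

end RightModFunctor

namespace LeftModFunctor

variable {R : Type u} [Ring R]

/-- The natural morphism `F → F^{**}`: an element `x ∈ F(S)` goes to the morphism `(F^*)|_S → 𝓢`
which on an `S`-algebra `h : S ⟶ T` sends `φ ∈ F^*(T) = Hom_𝓣(F|_T, 𝓣)` to `φ_T(x|_T)`. -/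
def toBidual (F : LeftModFunctor.{u, w} R) : Hom F F.dual.dual where
  app S :=
    { toFun := fun x => ⟨fun T h =>
          { toFun := fun φ => φ.1 T (𝟙 T) (F.map h x)
            map_add' := fun _ _ => rfl
            map_smul' := fun t φ => rfl },
        fun T T' h g φ => by
          change φ.1 T' (g ≫ 𝟙 T') (F.map (h ≫ g) x) = RAlg.hom g (φ.1 T (𝟙 T) (F.map h x))
          rw [F.map_comp, Category.comp_id]
          have := φ.2 T T' (𝟙 T) g (F.map h x)
          rwa [Category.id_comp] at this⟩
      map_add' := fun x y => Subtype.ext <| funext fun T => funext fun h =>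
        LinearMap.ext fun φ => by
        change φ.1 T (𝟙 T) (F.map h (x + y)) =
          φ.1 T (𝟙 T) (F.map h x) + φ.1 T (𝟙 T) (F.map h y)
        rw [map_add, map_add]
      map_smul' := fun s x => Subtype.ext <| funext fun T => funext fun h =>
        LinearMap.ext fun φ => by
        change φ.1 T (𝟙 T) (F.map h (s • x)) = RAlg.hom h s • φ.1 T (𝟙 T) (F.map h x)
        rw [LinearMap.map_smulₛₗ, map_smul] }
  naturality {S S'} f x := Subtype.ext <| funext fun T => funext fun h =>
    LinearMap.ext fun φ => by
    change φ.1 T (𝟙 T) (F.map h (F.map f x)) = φ.1 T (𝟙 T) (F.map (f ≫ h) x)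
    rw [F.map_comp]

end LeftModFunctor

section BaseChange

variable {R : Type u} [Ring R] (M : Type u) [AddCommGroup M]

/-- The map `s ⊗ m ↦ f(s) ⊗ m` on tensor products over `ℤ`. -/
noncomputable def intTensorMap {S T : RAlg R} (f : S ⟶ T) :
    (S.right ⊗[ℤ] M) →ₛₗ[RAlg.hom f] (T.right ⊗[ℤ] M) where
  toFun := TensorProduct.map (RAlg.hom f).toAddMonoidHom.toIntLinearMap LinearMap.id
  map_add' := map_add _
  map_smul' s x := by
    induction x using TensorProduct.induction_on with
    | zero => simp
    | tmul a m => simp [TensorProduct.smul_tmul']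
    | add x y hx hy => rw [smul_add, map_add, hx, hy, map_add, smul_add]

theorem intTensorMap_tmul {S T : RAlg R} (f : S ⟶ T) (s : S.right) (m : M) :
    intTensorMap M f (s ⊗ₜ[ℤ] m) = RAlg.hom f s ⊗ₜ[ℤ] m := rfl

variable [Module R M]

/-- The relations `s r ⊗ m = s ⊗ r m` defining `S ⊗_R M` as a quotient of `S ⊗_ℤ M`. -/
def balancingRelations (S : RAlg R) : Submodule S.right (S.right ⊗[ℤ] M) :=
  Submodule.span S.right
    {x | ∃ (s : S.right) (r : R) (m : M), x = (s * S.str r) ⊗ₜ[ℤ] m - s ⊗ₜ[ℤ] (r • m)}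

/-- The tensor product `S ⊗_R M` over the noncommutative ring `R`, with its left `S`-module
structure. (The span of the relations over `S` is their additive span, since the set of the
relations is stable under left multiplication by `S`.) -/
abbrev BaseChange (S : RAlg R) : Type u := (S.right ⊗[ℤ] M) ⧸ balancingRelations M S

theorem balancingRelations_le {S T : RAlg R} (f : S ⟶ T) :
    balancingRelations M S ≤ (balancingRelations M T).comap (intTensorMap M f) := by
  refine Submodule.span_le.2 ?_
  rintro _ ⟨s, r, m, rfl⟩
  refine Submodule.subset_span ⟨RAlg.hom f s, r, m, ?_⟩
  rw [map_sub, intTensorMap_tmul, intTensorMap_tmul, map_mul, RAlg.hom_str]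

/-- The quasi-coherent `𝓡`-module `𝓜` associated with an `R`-module `M`: `𝓜(S) = S ⊗_R M`, with
transition maps `s ⊗ m ↦ f(s) ⊗ m`. -/
noncomputable def quasiCoherent : LeftModFunctor.{u, u} R where
  obj S := BaseChange M S
  map {S T} f := Submodule.mapQ _ _ (intTensorMap M f) (balancingRelations_le M f)
  map_id S x := by
    obtain ⟨x, rfl⟩ := Submodule.Quotient.mk_surjective _ x
    rw [Submodule.mapQ_apply]
    congr 1
    induction x using TensorProduct.induction_on with
    | zero => simp
    | tmul a m => rfl
    | add x y hx hy => rw [map_add, hx, hy]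
  map_comp {S T U} f g x := by
    obtain ⟨x, rfl⟩ := Submodule.Quotient.mk_surjective _ x
    rw [Submodule.mapQ_apply, Submodule.mapQ_apply, Submodule.mapQ_apply]
    congr 1
    induction x using TensorProduct.induction_on with
    | zero => simp
    | tmul a m => rfl
    | add x y hx hy => rw [map_add, hx, hy, map_add, map_add]

end BaseChange

/-! Write N = S ⊗_R M. An element of `𝓜^*(T)` is a map M → T semilinear along R → T. So Φ in
`𝓜^{**}(S)` attaches to each S-algebra T and each such φ an element Φ(φ) of T, naturally in T and
with Φ(φ·t) = Φ(φ)t.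

The decisive test algebras are T = End_ℤ(X), for S-modules X. There naturality makes Φ compatible
with S-linear maps X → X' that intertwine the two actions of M (`evalEnd_intertwine`), and right
linearity makes it commute with precomposition by every additive endomorphism, S-linear or not
(`evalEnd_precomp`).

Let m in M act on S × (N ⊗_ℤ S) by (z, y) ↦ (0, (1 ⊗ m) ⊗ z). The operator given by Φ sends (1, 0)
to a pair with second component Σ nᵢ ⊗ sᵢ. Mapping this universal example to an arbitrary φ and x ∈
X gives Φ(φ)(x) = Σ φ(nᵢ)(sᵢ x), with φ extended to N (`evalEnd_eq_contract`).

The same example over S ⊗_ℤ S, precomposed with the swap, which fixes 1 ⊗ 1, forces Σ nᵢ ⊗ 1 ⊗ sᵢ =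
Σ nᵢ ⊗ sᵢ ⊗ 1. Hence the tensor is n ⊗ 1 with n = Σ sᵢ nᵢ (`tensor_eq`). Letting T act on itself by
left multiplication then shows that Φ is evaluation at n (`eval_eq_lift_map`). -/

section Reflexivity

variable {R : Type u} [Ring R] {M : Type u} [AddCommGroup M] [Module R M]

/-! ### The universal property of `S ⊗_R M`. -/

namespace BaseChange

/-- The canonical map `M → S ⊗_R M`, `m ↦ 1 ⊗ m`, semilinear along `R → S`. -/
def of (S : RAlg R) : M →ₛₗ[S.str] BaseChange M S where
  toFun m := Submodule.Quotient.mk ((1 : S.right) ⊗ₜ[ℤ] m)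
  map_add' m m' := by rw [TensorProduct.tmul_add, Submodule.Quotient.mk_add]
  map_smul' r m := by
    rw [← Submodule.Quotient.mk_smul, TensorProduct.smul_tmul', eq_comm, Submodule.Quotient.eq]
    exact Submodule.subset_span ⟨1, r, m, by rw [smul_eq_mul, one_mul, mul_one]⟩

/-- Elements of `S ⊗_R M` are sums of elements `s • (1 ⊗ m)`. -/
theorem induction_of {S : RAlg R} {p : BaseChange M S → Prop} (x : BaseChange M S)
    (zero : p 0) (smul_of : ∀ (s : S.right) (m : M), p (s • of S m))
    (add : ∀ x y, p x → p y → p (x + y)) : p x := by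
  obtain ⟨x, rfl⟩ := Submodule.Quotient.mk_surjective _ x
  induction x using TensorProduct.induction_on with
  | zero => exact zero
  | tmul s m =>
    have h := smul_of s m
    change p (Submodule.Quotient.mk (s • ((1 : S.right) ⊗ₜ[ℤ] m))) at h
    rwa [TensorProduct.smul_tmul', smul_eq_mul, mul_one] at h
  | add x y hx hy => exact add _ _ hx hy

variable {S : RAlg R} {P : Type*} [AddCommGroup P] [Module S.right P]

/-- The `S`-linear extension to `S ⊗_R M` of a map `M → P` semilinear along `R → S`. -/
noncomputable def lift (g : M →ₛₗ[S.str] P) : BaseChange M S →ₗ[S.right] P :=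
  Submodule.liftQ _
    (TensorProduct.AlgebraTensorModule.lift
      { toFun := fun s => s • g.toAddMonoidHom.toIntLinearMap
        map_add' := fun s t => add_smul s t _
        map_smul' := fun s t => mul_smul s t _ }) <| by
    refine Submodule.span_le.2 ?_
    rintro _ ⟨s, r, m, rfl⟩
    rw [SetLike.mem_coe, LinearMap.mem_ker, map_sub, sub_eq_zero]
    change (s * S.str r) • g m = s • g (r • m)
    rw [LinearMap.map_smulₛₗ, mul_smul]

@[simp]
theorem lift_of (g : M →ₛₗ[S.str] P) (m : M) : lift g (of S m) = g m :=
  one_smul _ (g m)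

/-- The transition map `S ⊗_R M → T ⊗_R M` of `𝓜`. -/
noncomputable abbrev map {S T : RAlg R} (f : S ⟶ T) :
    BaseChange M S →ₛₗ[RAlg.hom f] BaseChange M T :=
  Submodule.mapQ _ _ (intTensorMap M f) (balancingRelations_le M f)

theorem map_of {S T : RAlg R} (f : S ⟶ T) (m : M) : map f (of S m) = of T m := by
  change Submodule.Quotient.mk (RAlg.hom f 1 ⊗ₜ[ℤ] m) = _
  rw [map_one]; rfl

/-- Maps out of `S ⊗_R M` semilinear along `S → T` are determined on the elements `1 ⊗ m`. -/
theorem hom_ext {S T : RAlg R} {k : S.right →+* T.right} {P : Type*} [AddCommGroup P]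
    [Module T.right P] {f g : BaseChange M S →ₛₗ[k] P} (h : ∀ m, f (of S m) = g (of S m)) :
    f = g := by
  refine LinearMap.ext fun x => ?_
  induction x using induction_of with
  | zero => rw [map_zero, map_zero]
  | smul_of s m => rw [LinearMap.map_smulₛₗ, LinearMap.map_smulₛₗ, h]
  | add x y hx hy => rw [map_add, map_add, hx, hy]

end BaseChange

/-! ### The dual `𝓜^*(S)` as semilinear maps M → S. -/

namespace RAlg

/-- Postcomposition of a semilinear map `M → S` with a morphism of `R`-algebras. -/
def compSemilinear {S T : RAlg R} (f : S ⟶ T) (φ : M →ₛₗ[S.str] S.right) :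
    M →ₛₗ[T.str] T.right where
  toFun m := hom f (φ m)
  map_add' m m' := by rw [map_add, map_add]
  map_smul' r m := by
    rw [LinearMap.map_smulₛₗ, smul_eq_mul, map_mul, hom_str, smul_eq_mul]

end RAlg

open LeftModFunctor BaseChange

theorem BaseChange.lift_map {S T U : RAlg R} (h : S ⟶ T) (g : T ⟶ U)
    (φ : M →ₛₗ[S.str] S.right) (x : BaseChange M T) :
    lift (RAlg.compSemilinear (h ≫ g) φ) (map g x) =
      RAlg.hom g (lift (RAlg.compSemilinear h φ) x) := by
  induction x using induction_of with
  | zero => rw [map_zero, map_zero, map_zero, map_zero]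
  | smul_of s m =>
    rw [LinearMap.map_smulₛₗ, map_smul, map_smul, map_of, lift_of, lift_of, smul_eq_mul,
      smul_eq_mul, map_mul]
    rfl
  | add x y hx hy => rw [map_add, map_add, map_add, map_add, hx, hy]

/-- The element of `𝓜^*(S)` given by a semilinear map `M → S`. -/
noncomputable def dualOf {S : RAlg R} (φ : M →ₛₗ[S.str] S.right) :
    (quasiCoherent (R := R) M).dual.obj S :=
  ⟨fun _ h => lift (RAlg.compSemilinear h φ), fun _ _ h g x => lift_map h g φ x⟩

theorem dualOf_of {S : RAlg R} (φ : M →ₛₗ[S.str] S.right) {T : RAlg R} (h : S ⟶ T) (m : M) :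
    (dualOf φ).1 T h (of T m) = RAlg.hom h (φ m) :=
  lift_of (RAlg.compSemilinear h φ) m

/-- Naturality along the structure map S → T transports the values at S to T, where the elements 1 ⊗
m generate. -/
theorem dual_ext {S : RAlg R} {ψ ψ' : (quasiCoherent (R := R) M).dual.obj S}
    (h : ∀ m, ψ.1 S (𝟙 S) (of S m) = ψ'.1 S (𝟙 S) (of S m)) : ψ = ψ' := by
  refine Subtype.ext <| funext fun T => funext fun f => hom_ext fun m => ?_
  have e : ψ.1 T (𝟙 S ≫ f) (map f (of S m)) = _ := ψ.2 S T (𝟙 S) f (of S m)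
  have e' : ψ'.1 T (𝟙 S ≫ f) (map f (of S m)) = _ := ψ'.2 S T (𝟙 S) f (of S m)
  rw [map_of, Category.id_comp] at e e'
  exact e.trans ((congrArg _ (h m)).trans e'.symm)

/-- The semilinear map `M → S` underlying an element of `𝓜^*(S)`. -/
noncomputable def toSemilinear {S : RAlg R} (ψ : (quasiCoherent (R := R) M).dual.obj S) :
    M →ₛₗ[S.str] S.right := LinearMap.comp (ψ.1 S (𝟙 S)) (of S)

theorem dualOf_toSemilinear {S : RAlg R} (ψ : (quasiCoherent (R := R) M).dual.obj S) :
    dualOf (toSemilinear ψ) = ψ :=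
  dual_ext fun m => dualOf_of _ (𝟙 S) m

theorem dual_map_dualOf {S T : RAlg R} (f : S ⟶ T) (φ : M →ₛₗ[S.str] S.right) :
    (quasiCoherent (R := R) M).dual.map f (dualOf φ) = dualOf (RAlg.compSemilinear f φ) :=
  dual_ext fun m => (dualOf_of φ (f ≫ 𝟙 T) m).trans
    (dualOf_of (RAlg.compSemilinear f φ) (𝟙 T) m).symm

/-- Right multiplication of a semilinear map `M → S` by an element of `S`. -/
def mulRightSemilinear {S : RAlg R} (φ : M →ₛₗ[S.str] S.right) (t : S.right) :
    M →ₛₗ[S.str] S.right where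
  toFun m := φ m * t
  map_add' m m' := by rw [map_add, add_mul]
  map_smul' r m := by rw [LinearMap.map_smulₛₗ, smul_eq_mul, mul_assoc, smul_eq_mul]

theorem op_smul_dualOf {S : RAlg R} (φ : M →ₛₗ[S.str] S.right) (t : S.right) :
    op t • dualOf φ = dualOf (mulRightSemilinear φ t) :=
  dual_ext fun m => (congrArg (· * t) (dualOf_of φ (𝟙 S) m)).trans
    (dualOf_of (mulRightSemilinear φ t) (𝟙 S) m).symm

/-! ### Elements of the bidual as natural, right-linear operations on semilinear maps. -/

namespace Bidual

variable {S : RAlg R} (Φ : (quasiCoherent (R := R) M).dual.dual.obj S)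

/-- The value of an element of `𝓜^{**}(S)` on a semilinear map `M → T`, for an `S`-algebra `T`. -/
noncomputable def eval {T : RAlg R} (h : S ⟶ T) (φ : M →ₛₗ[T.str] T.right) : T.right :=
  Φ.1 T h (dualOf φ)

theorem eval_comp {T U : RAlg R} (h : S ⟶ T) (g : T ⟶ U) (φ : M →ₛₗ[T.str] T.right) :
    eval Φ (h ≫ g) (RAlg.compSemilinear g φ) = RAlg.hom g (eval Φ h φ) := by
  have e := Φ.2 T U h g (dualOf φ)
  rw [dual_map_dualOf] at e
  exact e

theorem eval_mulRight {T : RAlg R} (h : S ⟶ T) (φ : M →ₛₗ[T.str] T.right) (t : T.right) :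
    eval Φ h (mulRightSemilinear φ t) = eval Φ h φ * t := by
  have e := (Φ.1 T h).map_smul (op t) (dualOf φ)
  rw [op_smul_dualOf] at e
  exact e

variable {Φ} in
theorem ext {Ψ : (quasiCoherent (R := R) M).dual.dual.obj S}
    (H : ∀ (T : RAlg R) (h : S ⟶ T) (φ : M →ₛₗ[T.str] T.right), eval Φ h φ = eval Ψ h φ) :
    Φ = Ψ :=
  Subtype.ext <| funext fun T => funext fun h => LinearMap.ext fun ψ => by
    rw [← dualOf_toSemilinear ψ]; exact H T h _

theorem eval_toBidual (x : BaseChange M S) {T : RAlg R} (h : S ⟶ T)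
    (φ : M →ₛₗ[T.str] T.right) :
    eval ((toBidual (quasiCoherent (R := R) M)).app S x) h φ = lift φ (map h x) := by
  change lift (RAlg.compSemilinear (𝟙 T) φ) (map h x) = _
  rfl

end Bidual

/-! ### Test algebras: endomorphism rings of S-modules. -/

namespace RAlg

/-- The `R`-algebra underlying a ring under an `R`-algebra `S`. -/
abbrev ofRingHom {S : RAlg R} {A : Type u} [Ring A] (ρ : S.right →+* A) : RAlg R :=
  Under.mk (RingCat.ofHom (ρ.comp S.str))

/-- The structure morphism of a ring under an `R`-algebra `S`. -/
abbrev toOfRingHom {S : RAlg R} {A : Type u} [Ring A] (ρ : S.right →+* A) : S ⟶ ofRingHom ρ :=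
  Under.homMk (RingCat.ofHom ρ) rfl

/-- The morphism of `R`-algebras given by a morphism of rings under `S`. -/
abbrev ofRingHomMap {S : RAlg R} {A B : Type u} [Ring A] [Ring B] {ρ : S.right →+* A}
    {σ : S.right →+* B} (f : A →+* B) (hf : f.comp ρ = σ) : ofRingHom ρ ⟶ ofRingHom σ :=
  Under.homMk (RingCat.ofHom f) (by subst hf; rfl)

end RAlg

variable {S : RAlg R} {X X' : Type u} [AddCommGroup X] [Module S.right X]
  [AddCommGroup X'] [Module S.right X']

/-- The action of `S` on an `S`-module by additive endomorphisms. -/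
abbrev actionEnd (S : RAlg R) (X : Type u) [AddCommGroup X] [Module S.right X] :
    S.right →+* Module.End ℤ X := Module.toModuleEnd ℤ X

/-- A semilinear map into `End_ℤ(X)`, viewed as an algebra under `S`. -/
def endSemilinear (φ : M →ₛₗ[S.str] Module.End ℤ X) :
    M →ₛₗ[(RAlg.ofRingHom (actionEnd S X)).str] (RAlg.ofRingHom (actionEnd S X)).right where
  toFun := φ
  map_add' := φ.map_add
  map_smul' := φ.map_smulₛₗ

/-- The ring of pairs of additive endomorphisms of `X` and `X'` intertwined by `f`. -/
def intertwiners (f : X →ₗ[S.right] X') : Subring (Module.End ℤ X × Module.End ℤ X') where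
  carrier := {p | ∀ x, f (p.1 x) = p.2 (f x)}
  mul_mem' {_ q} hp hq x := (hp (q.1 x)).trans (congrArg _ (hq x))
  one_mem' _ := rfl
  add_mem' hp hq x := (map_add f _ _).trans (congrArg₂ (· + ·) (hp x) (hq x))
  zero_mem' _ := map_zero f
  neg_mem' hp x := (map_neg f _).trans (congrArg (- ·) (hp x))

/-- The action of `S` on a pair of modules related by a linear map. -/
def actionIntertwiners (f : X →ₗ[S.right] X') : S.right →+* intertwiners f :=
  ((actionEnd S X).prod (actionEnd S X')).codRestrict (intertwiners f) fun s x => map_smul f s x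

namespace Bidual

variable (Φ : (quasiCoherent (R := R) M).dual.dual.obj S)

/-- The value of an element of `𝓜^{**}(S)` on a semilinear map `M → End_ℤ(X)`. -/
noncomputable def evalEnd (φ : M →ₛₗ[S.str] Module.End ℤ X) : Module.End ℤ X :=
  eval Φ (RAlg.toOfRingHom (actionEnd S X)) (endSemilinear φ)

/-- The pair (φ, φ') takes values in the ring `intertwiners f`, an S-algebra because f is S-linear.
Naturality along its two projections shows that the two values of Φ are the components of one
element of that ring. -/
theorem evalEnd_intertwine (f : X →ₗ[S.right] X') (φ : M →ₛₗ[S.str] Module.End ℤ X)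
    (φ' : M →ₛₗ[S.str] Module.End ℤ X') (hf : ∀ m x, f (φ m x) = φ' m (f x)) (x : X) :
    f (evalEnd Φ φ x) = evalEnd Φ φ' (f x) := by
  let θ : M →ₛₗ[(RAlg.ofRingHom (actionIntertwiners f)).str]
      (RAlg.ofRingHom (actionIntertwiners f)).right :=
    { toFun := fun m => (⟨(φ m, φ' m), hf m⟩ : intertwiners f)
      map_add' := fun m m' => Subtype.ext (Prod.ext (φ.map_add m m') (φ'.map_add m m'))
      map_smul' := fun r m => Subtype.ext (Prod.ext (φ.map_smulₛₗ r m) (φ'.map_smulₛₗ r m)) }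
  let p : intertwiners f →+* Module.End ℤ X := (RingHom.fst _ _).comp (intertwiners f).subtype
  let q : intertwiners f →+* Module.End ℤ X' := (RingHom.snd _ _).comp (intertwiners f).subtype
  have hp := eval_comp Φ (RAlg.toOfRingHom (actionIntertwiners f))
    (RAlg.ofRingHomMap (σ := actionEnd S X) p rfl) θ
  have hq := eval_comp Φ (RAlg.toOfRingHom (actionIntertwiners f))
    (RAlg.ofRingHomMap (σ := actionEnd S X') q rfl) θ
  have h1 : evalEnd Φ φ = p (eval Φ (RAlg.toOfRingHom (actionIntertwiners f)) θ) := hp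
  have h2 : evalEnd Φ φ' = q (eval Φ (RAlg.toOfRingHom (actionIntertwiners f)) θ) := hq
  rw [h1, h2]
  exact Subtype.prop (p := (· ∈ intertwiners f))
    (eval Φ (RAlg.toOfRingHom (actionIntertwiners f)) θ) x

/-- Precomposition of a semilinear map `M → End_ℤ(X)` with an additive endomorphism of `X`. -/
def precomp (φ : M →ₛₗ[S.str] Module.End ℤ X) (t : Module.End ℤ X) :
    M →ₛₗ[S.str] Module.End ℤ X where
  toFun m := φ m * t
  map_add' m m' := by rw [map_add, add_mul]
  map_smul' r m := by rw [LinearMap.map_smulₛₗ]; rfl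

/-- Right multiplication in End_ℤ(X) is precomposition. Since t need not be S-linear, this is not a
case of `evalEnd_intertwine`. -/
theorem evalEnd_precomp (φ : M →ₛₗ[S.str] Module.End ℤ X) (t : Module.End ℤ X) (x : X) :
    evalEnd Φ (precomp φ t) x = evalEnd Φ φ (t x) :=
  LinearMap.congr_fun
    (eval_mulRight Φ (RAlg.toOfRingHom (actionEnd S X)) (endSemilinear φ) t) x

end Bidual

/-! ### The universal action of M and its contractions. -/

/-- For `φ : M → End_ℤ(X)` semilinear and `t : Z → X` additive, the `S`-linear map
`n ⊗ z ↦ φ(n)(t(z))` on `(S ⊗_R M) ⊗_ℤ Z`. -/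
noncomputable def contract {Z : Type u} [AddCommGroup Z] (φ : M →ₛₗ[S.str] Module.End ℤ X)
    (t : Z →ₗ[ℤ] X) : BaseChange M S ⊗[ℤ] Z →ₗ[S.right] X :=
  TensorProduct.AlgebraTensorModule.lift
    { toFun := fun n => (lift φ n).comp t
      map_add' := fun n n' => by rw [map_add]; rfl
      map_smul' := fun s n => by rw [map_smul]; rfl }

theorem contract_tmul {Z : Type u} [AddCommGroup Z] (φ : M →ₛₗ[S.str] Module.End ℤ X)
    (t : Z →ₗ[ℤ] X) (n : BaseChange M S) (z : Z) : contract φ t (n ⊗ₜ z) = lift φ n (t z) :=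
  rfl

/-- The semilinear map `M → End_ℤ(Z × (S ⊗_R M) ⊗_ℤ Z)` with `m(z, y) = (0, (1 ⊗ m) ⊗ z)`. -/
noncomputable def tensorEnd (M : Type u) [AddCommGroup M] [Module R M] (S : RAlg R) (Z : Type u)
    [AddCommGroup Z] [Module S.right Z] :
    M →ₛₗ[S.str] Module.End ℤ (Z × (BaseChange M S ⊗[ℤ] Z)) where
  toFun m := LinearMap.inr ℤ _ _ ∘ₗ TensorProduct.mk ℤ _ _ (of S m) ∘ₗ LinearMap.fst ℤ _ _
  map_add' m m' := LinearMap.ext fun x => Prod.ext (add_zero _).symm <|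
    (congrArg (· ⊗ₜ x.1) (map_add (of S) m m')).trans (TensorProduct.add_tmul _ _ _)
  map_smul' r m := LinearMap.ext fun x => Prod.ext (smul_zero _).symm <|
    congrArg (· ⊗ₜ x.1) ((of S).map_smulₛₗ r m)

theorem lift_tensorEnd {Z : Type u} [AddCommGroup Z] [Module S.right Z] (n : BaseChange M S)
    (x : Z × (BaseChange M S ⊗[ℤ] Z)) : lift (tensorEnd M S Z) n x = (0, n ⊗ₜ x.1) := by
  induction n using induction_of with
  | zero => rw [map_zero, TensorProduct.zero_tmul]; rfl
  | smul_of s m =>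
    rw [map_smul, lift_of, LinearMap.smul_apply]
    exact Prod.ext (smul_zero _) rfl
  | add n n' hn hn' =>
    rw [map_add, LinearMap.add_apply, hn, hn', TensorProduct.add_tmul]
    exact Prod.ext (add_zero _) rfl

theorem contract_tensorEnd {Y Z : Type u} [AddCommGroup Y] [AddCommGroup Z] [Module S.right Z]
    (t : Y →ₗ[ℤ] Z × (BaseChange M S ⊗[ℤ] Z)) (a : BaseChange M S ⊗[ℤ] Y) :
    contract (tensorEnd M S Z) t a =
      (0, TensorProduct.map LinearMap.id (LinearMap.fst ℤ _ _ ∘ₗ t) a) := by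
  induction a using TensorProduct.induction_on with
  | zero => rw [map_zero, map_zero]; rfl
  | tmul n y => rw [contract_tmul, lift_tensorEnd]; rfl
  | add a b ha hb =>
    rw [map_add, map_add, ha, hb]
    exact Prod.ext (add_zero _) rfl

/-- The diagonal action on `X × X`. -/
def diagEnd (φ : M →ₛₗ[S.str] Module.End ℤ X) : M →ₛₗ[S.str] Module.End ℤ (X × X) where
  toFun m := (φ m).prodMap (φ m)
  map_add' m m' := by rw [map_add]; rfl
  map_smul' r m := by rw [LinearMap.map_smulₛₗ]; rfl

/-! ### The tensor attached to an element of the bidual, and its descent to `S ⊗_R M`. -/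

namespace Bidual

variable (Φ : (quasiCoherent (R := R) M).dual.dual.obj S)

/-- The element of `(S ⊗_R M) ⊗_ℤ S` determining an element of `𝓜^{**}(S)`. -/
noncomputable def tensor : BaseChange M S ⊗[ℤ] S.right :=
  (evalEnd Φ (tensorEnd M S S.right) (1, 0)).2

/-- The universal action has square zero, so it is compared with the action (a, b) ↦ (0, φ(m)a) on X
× X, and the latter with φ itself. -/
theorem evalEnd_eq_contract (φ : M →ₛₗ[S.str] Module.End ℤ X) (x : X) :
    evalEnd Φ φ x =
      contract φ ((LinearMap.toSpanSingleton S.right X x).restrictScalars ℤ) (tensor Φ) := by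
  let c := contract φ ((LinearMap.toSpanSingleton S.right X x).restrictScalars ℤ)
  -- The shift (a, b) ↦ (0, a): the square-zero action is the diagonal one precomposed with ε, so
  -- `evalEnd_precomp` removes it.
  let ε : Module.End ℤ (X × X) := LinearMap.inr ℤ X X ∘ₗ LinearMap.fst ℤ X X
  have h := evalEnd_intertwine Φ ((LinearMap.toSpanSingleton S.right X x).prodMap c)
    (tensorEnd M S S.right) (precomp (diagEnd φ) ε)
    (fun m y => Prod.ext
      ((zero_smul S.right x).trans (map_zero (φ m)).symm) (by
        change c (of S m ⊗ₜ y.1) = φ m (y.1 • x)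
        exact (contract_tmul φ _ _ _).trans (by rw [lift_of]; rfl))) (1, 0)
  have h' := evalEnd_intertwine Φ (LinearMap.inr S.right X X) φ (diagEnd φ)
    (fun m y => Prod.ext (map_zero (φ m)).symm rfl) x
  rw [evalEnd_precomp] at h
  have e : ε (((LinearMap.toSpanSingleton S.right X x).prodMap c) (1, 0)) =
      LinearMap.inr S.right X X x := Prod.ext rfl (one_smul S.right x)
  rw [e, ← h'] at h
  exact (congrArg Prod.snd h).symm

/-- The `S`-action as an additive map `(S ⊗_R M) ⊗_ℤ S → S ⊗_R M`, `n ⊗ s ↦ s n`. -/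
noncomputable def act (M : Type u) [AddCommGroup M] [Module R M] (S : RAlg R) :
    BaseChange M S ⊗[ℤ] S.right →ₗ[ℤ] BaseChange M S :=
  TensorProduct.lift (actionEnd S (BaseChange M S)).toAddMonoidHom.toIntLinearMap.flip

theorem act_tmul (n : BaseChange M S) (s : S.right) : act M S (n ⊗ₜ s) = s • n := rfl

/-- The additive map `n ⊗ (s ⊗ s') ↦ s n ⊗ s'`. -/
noncomputable def actLeft (M : Type u) [AddCommGroup M] [Module R M] (S : RAlg R) :
    BaseChange M S ⊗[ℤ] (S.right ⊗[ℤ] S.right) →ₗ[ℤ] BaseChange M S ⊗[ℤ] S.right :=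
  TensorProduct.map (act M S) LinearMap.id ∘ₗ
    (TensorProduct.assoc ℤ (BaseChange M S) S.right S.right).symm.toLinearMap

theorem lift_precomp (φ : M →ₛₗ[S.str] Module.End ℤ X) (t : Module.End ℤ X)
    (n : BaseChange M S) : lift (precomp φ t) n = lift φ n * t := by
  induction n using induction_of with
  | zero => rw [map_zero, map_zero, zero_mul]
  | smul_of s m => rw [map_smul, map_smul, lift_of, lift_of]; rfl
  | add n n' hn hn' => rw [map_add, map_add, hn, hn', add_mul]

theorem contract_precomp {Z : Type u} [AddCommGroup Z] (φ : M →ₛₗ[S.str] Module.End ℤ X)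
    (t : Module.End ℤ X) (k : Z →ₗ[ℤ] X) (a : BaseChange M S ⊗[ℤ] Z) :
    contract (precomp φ t) k a = contract φ (t ∘ₗ k) a := by
  induction a using TensorProduct.induction_on with
  | zero => rw [map_zero, map_zero]
  | tmul n z => rw [contract_tmul, contract_tmul, lift_precomp]; rfl
  | add a b ha hb => rw [map_add, map_add, ha, hb]

theorem actLeft_map_tmul_one (a : BaseChange M S ⊗[ℤ] S.right) :
    actLeft M S (TensorProduct.map LinearMap.id ((TensorProduct.mk ℤ S.right S.right).flip 1) a) =
      act M S a ⊗ₜ 1 :=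
  LinearMap.congr_fun (f := actLeft M S ∘ₗ
    TensorProduct.map LinearMap.id ((TensorProduct.mk ℤ S.right S.right).flip 1))
    (g := (TensorProduct.mk ℤ _ S.right).flip 1 ∘ₗ act M S) (TensorProduct.ext' fun _ _ => rfl) a

theorem actLeft_map_one_tmul (a : BaseChange M S ⊗[ℤ] S.right) :
    actLeft M S (TensorProduct.map LinearMap.id (TensorProduct.mk ℤ S.right S.right 1) a) = a :=
  LinearMap.congr_fun (f := actLeft M S ∘ₗ
    TensorProduct.map LinearMap.id (TensorProduct.mk ℤ S.right S.right 1))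
    (g := LinearMap.id)
    (TensorProduct.ext' fun n s => congrArg (· ⊗ₜ s) (one_smul S.right n)) a

/-- A descent argument: the two images of the tensor in N ⊗ S ⊗ S, with 1 inserted on either side of
the S factor, agree, and `actLeft` collapses that equality. -/
theorem tensor_eq : tensor Φ = act M S (tensor Φ) ⊗ₜ 1 := by
  -- The swap fixes 1 ⊗ 1 but sends s ⊗ 1 to 1 ⊗ s; it is additive, not S-linear for the left
  -- action.
  let t : Module.End ℤ ((S.right ⊗[ℤ] S.right) ×
      (BaseChange M S ⊗[ℤ] (S.right ⊗[ℤ] S.right))) :=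
    (TensorProduct.comm ℤ S.right S.right).toLinearMap.prodMap LinearMap.id
  have h : evalEnd Φ (precomp (tensorEnd M S _) t) (1 ⊗ₜ 1, 0) =
      evalEnd Φ (tensorEnd M S _) (1 ⊗ₜ 1, 0) := evalEnd_precomp Φ _ t _
  rw [evalEnd_eq_contract, evalEnd_eq_contract, contract_precomp, contract_tensorEnd,
    contract_tensorEnd] at h
  have h2 := congrArg (actLeft M S) (congrArg Prod.snd h)
  have e : (LinearMap.fst ℤ _ _ ∘ₗ t ∘ₗ (LinearMap.toSpanSingleton S.right
      ((S.right ⊗[ℤ] S.right) × (BaseChange M S ⊗[ℤ] (S.right ⊗[ℤ] S.right)))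
      (1 ⊗ₜ 1, 0)).restrictScalars ℤ) = TensorProduct.mk ℤ S.right S.right 1 :=
    LinearMap.ext fun s => by
      change TensorProduct.comm ℤ S.right S.right ((s * 1) ⊗ₜ 1) = 1 ⊗ₜ s
      rw [mul_one]; rfl
  have e' : (LinearMap.fst ℤ _ _ ∘ₗ (LinearMap.toSpanSingleton S.right
      ((S.right ⊗[ℤ] S.right) × (BaseChange M S ⊗[ℤ] (S.right ⊗[ℤ] S.right)))
      (1 ⊗ₜ 1, 0)).restrictScalars ℤ) = (TensorProduct.mk ℤ S.right S.right).flip 1 :=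
    LinearMap.ext fun s => by
      change (s * 1) ⊗ₜ 1 = s ⊗ₜ 1
      rw [mul_one]
  rw [e, e'] at h2
  exact (actLeft_map_one_tmul _).symm.trans (h2.trans (actLeft_map_tmul_one _))

/-- An element of `𝓜^{**}(S)` is evaluation at an element of `S ⊗_R M`. -/
theorem eval_eq_lift_map {T : RAlg R} (h : S ⟶ T) (φ : M →ₛₗ[T.str] T.right) :
    eval Φ h φ = lift φ (map h (act M S (tensor Φ))) := by
  -- Take X = T. Left multiplication T → End_ℤ(T) is a morphism of S-algebras, and evaluation at 1
  -- recovers an element of T from its image.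
  let _ : Module S.right T.right := Module.compHom _ (RAlg.hom h)
  let ℓ : T.right →+* Module.End ℤ T.right := Module.toModuleEnd ℤ T.right
  let g : T ⟶ RAlg.ofRingHom (actionEnd S T.right) :=
    Under.homMk (RingCat.ofHom ℓ) (by
      ext r
      refine LinearMap.ext fun x => ?_
      change T.str r * x = RAlg.hom h (S.str r) * x
      rw [RAlg.hom_str])
  let ψ : M →ₛₗ[S.str] Module.End ℤ T.right :=
    { toFun := fun m => ℓ (φ m)
      map_add' := fun m m' => by rw [map_add, map_add]
      map_smul' := fun r m => LinearMap.ext fun x => by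
        change φ (r • m) * x = RAlg.hom h (S.str r) * (φ m * x)
        rw [LinearMap.map_smulₛₗ, RAlg.hom_str, smul_eq_mul, mul_assoc] }
  have hg : h ≫ g = RAlg.toOfRingHom (actionEnd S T.right) := rfl
  have key : evalEnd Φ ψ = ℓ (eval Φ h φ) := eval_comp Φ h g φ
  have key1 : evalEnd Φ ψ 1 = eval Φ h φ :=
    (LinearMap.congr_fun key 1).trans (mul_one (eval Φ h φ))
  rw [← key1, evalEnd_eq_contract, tensor_eq, contract_tmul]
  have h1 (n : BaseChange M S) : lift ψ n 1 = lift φ (map h n) := by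
    induction n using induction_of with
    | zero => rw [map_zero, map_zero, map_zero]; rfl
    | smul_of s m =>
      rw [map_smul, lift_of, LinearMap.map_smulₛₗ, map_smul, map_of, lift_of]
      change RAlg.hom h s * (φ m * 1) = _
      rw [mul_one]; rfl
    | add n n' hn hn' => rw [map_add, map_add, map_add, ← hn, ← hn']; rfl
  rw [← tensor_eq, ← h1]
  refine congrArg (lift ψ _) ?_
  change RAlg.hom h 1 * 1 = 1
  rw [map_one, mul_one]

/-- For evaluation at x, the universal action sends (1, 0) to (0, x ⊗ 1), and `act` turns x ⊗ 1 into
x. -/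
theorem act_tensor_toBidual (x : BaseChange M S) :
    act M S (tensor ((toBidual (quasiCoherent (R := R) M)).app S x)) = x := by
  have h1 {X : Type u} [AddCommGroup X] [Module S.right X] (φ : M →ₛₗ[S.str] Module.End ℤ X) :
      evalEnd ((toBidual (quasiCoherent (R := R) M)).app S x) φ = lift φ x := by
    refine (eval_toBidual x (RAlg.toOfRingHom (actionEnd S X)) (endSemilinear φ)).trans ?_
    induction x using induction_of with
    | zero => rw [map_zero, map_zero, map_zero]
    | smul_of s m =>
      rw [LinearMap.map_smulₛₗ, map_of, (lift φ).map_smul, lift_of, LinearMap.map_smul, lift_of]; rfl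
    | add n n' hn hn' => rw [map_add, map_add, map_add, ← hn, ← hn']
  rw [tensor, h1, lift_tensorEnd, act_tmul, one_smul]

end Bidual

end Reflexivity

theorem theorem5p4 (R : Type u) [Ring R] (M : Type u) [AddCommGroup M] [Module R M] :
    (LeftModFunctor.toBidual (quasiCoherent (R := R) M)).IsIso := by
  have right_inv (S : RAlg R) (Φ : (quasiCoherent (R := R) M).dual.dual.obj S) :
      (LeftModFunctor.toBidual (quasiCoherent (R := R) M)).app S (Bidual.act M S (Bidual.tensor Φ)) = Φ :=
    Bidual.ext fun T h φ =>
      (Bidual.eval_toBidual _ h φ).trans (Bidual.eval_eq_lift_map Φ h φ).symm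
  let e (S : RAlg R) : (quasiCoherent (R := R) M).obj S ≃ₗ[S.right]
      (quasiCoherent (R := R) M).dual.dual.obj S :=
    LinearEquiv.ofBijective ((LeftModFunctor.toBidual (quasiCoherent (R := R) M)).app S)
      ⟨Function.LeftInverse.injective (g := fun Φ => Bidual.act M S (Bidual.tensor Φ))
          Bidual.act_tensor_toBidual,
        fun Φ => ⟨_, right_inv S Φ⟩⟩
  refine ⟨⟨fun S => (e S).symm.toLinearMap, fun {S T} f Φ => ?_⟩,
    fun S x => (e S).symm_apply_apply x, fun S y => (e S).apply_symm_apply y⟩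
  -- Naturality of the inverse follows from that of `toBidual` by injectivity at T.
  refine (e T).injective (((e T).apply_symm_apply _).trans ?_)
  refine Eq.trans ?_ ((LeftModFunctor.toBidual (quasiCoherent (R := R) M)).naturality f ((e S).symm Φ)).symm
  exact congrArg _ ((e S).apply_symm_apply Φ).symm
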